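/- For a probability measure $\mu$ on a countable group $G$ let $H(\mu)=-\sum_{g\in G}\mu(g)\log\mu(g)$ be its Shannon entropy, let $\mu^{*n}$ be its $n$-th convolution power, and let $h(\mu)=\lim_{n\to\infty}H(\mu^{*n})/n\in[0,\infty]$ be its asymptotic entropy. There is a finitely generated group $G$ and there are probability measures $\mu$ and $\mu_k$, $k\ge 1$, on $G$ such that 1. there is a finite subset $F\subseteq G$ with $\operatorname{supp}\mu\subseteq F$ and $\operatorname{supp}\mu_k\subseteq F$ for all $k\ge 1$; 2. $\mu_k(g)\to\mu(g)$ as $k\to\infty$, for every $g\in G$; 3. $h(\mu_k)>0$ for all $k\ge 1$; 4. $\limsup_{k\to\infty}h(\mu_k)<h(\mu)$ (the limits defining $h(\mu)$ and all $h(\mu_k)$ exist). More precisely, each of the two groups $G=F_2\times(\mathbb{Z}/2\mathbb{Z}\wr D_\infty)$ and $G=F_2\times(\mathbb{Z}/2\mathbb{Z}\wr \mathrm{BS}(1,-1))$ is finitely generated and carries such measures. Here $F_2$ is the free group of rank $2$, $D_\infty$ is the infinite dihedral group, $\mathrm{BS}(1,-1)=\langle a,b\mid bab^{-1}=a^{-1}\rangle$,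 and $A\wr B=\left(\bigoplus_{B}A\right)\rtimes B$ is the restricted wreath product, with $B$ acting on $\bigoplus_B A$ by translation. -/

import Mathlib

open Filter Topology
open scoped ENNReal

noncomputable section

/-- The Shannon entropy `H(μ) = -∑ μ(g) log μ(g)`, with values in `[0, ∞]`
(every summand is nonnegative, since `0 ≤ μ(g) ≤ 1`). -/
def shannonEntropy {G : Type*} (μ : PMF G) : ℝ≥0∞ :=
  ∑' g : G, ENNReal.ofReal (Real.negMulLog (μ g).toReal)

/-- The convolution `μ * ν`: the law of the product `x * y` of independent elements
`x` of law `μ` and `y` of law `ν`. -/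
def convolution {G : Type*} [Group G] (μ ν : PMF G) : PMF G :=
  μ.bind fun x => ν.map fun y => x * y

/-- The convolution power `μ^{*n}`: the law of the `n`-th position of the `μ`-random walk
started at the identity. -/
def convolutionPow {G : Type*} [Group G] (μ : PMF G) : ℕ → PMF G
  | 0 => PMF.pure 1
  | n + 1 => convolution (convolutionPow μ n) μ

/-- The asymptotic entropy `h(μ) = lim H(μ^{*n}) / n`, with values in `[0, ∞]`. -/
def asymptoticEntropy {G : Type*} [Group G] (μ : PMF G) : ℝ≥0∞ :=
  limUnder atTop fun n : ℕ => shannonEntropy (convolutionPow μ n) / (n : ℝ≥0∞)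

/-- The limit that defines the asymptotic entropy of `μ` exists (in `[0, ∞]`). -/
def AsymptoticEntropyExists {G : Type*} [Group G] (μ : PMF G) : Prop :=
  Tendsto (fun n : ℕ => shannonEntropy (convolutionPow μ n) / (n : ℝ≥0∞)) atTop
    (𝓝 (asymptoticEntropy μ))

/-- There are probability measures `ν` and `ν₀, ν₁, …` on `G`, all supported in one finite set,
such that `ν_k → ν` pointwise and `h(ν_k) > 0` for every `k`, but `limsup h(ν_k) < h(ν)`. -/
def HasPositiveEntropyDiscontinuity (G : Type*) [Group G] : Prop :=
  ∃ (ν : PMF G) (νs : ℕ → PMF G),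
    (∃ F : Finset G, ν.support ⊆ F ∧ ∀ k, (νs k).support ⊆ F) ∧
    (∀ g : G, Tendsto (fun k => νs k g) atTop (𝓝 (ν g))) ∧
    AsymptoticEntropyExists ν ∧
    (∀ k, AsymptoticEntropyExists (νs k)) ∧
    (∀ k, 0 < asymptoticEntropy (νs k)) ∧
    limsup (fun k => asymptoticEntropy (νs k)) atTop < asymptoticEntropy ν

/-- The restricted wreath product `A ≀ B = (⨁_B A) ⋊ B`, as the subgroup of the unrestricted
wreath product `(B → A) ⋊ B` of the elements whose first component is finitely supported. -/
def restrictedWreathProduct (A B : Type*) [Group A] [Group B] :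
    Subgroup (RegularWreathProduct A B) where
  carrier := {x | (Function.mulSupport x.left).Finite}
  one_mem' := by simp
  mul_mem' := by
    intro x y hx hy
    refine (hx.union (hy.image fun b => x.right * b)).subset ?_
    refine (Function.mulSupport_mul _ _).trans (Set.union_subset_union_right _ ?_)
    intro b hb
    exact ⟨x.right⁻¹ * b, hb, by simp⟩
  inv_mem' := by
    intro x hx
    refine (hx.image fun b => x.right⁻¹ * b).subset ?_
    intro b hb
    refine ⟨x.right * b, ?_, by simp⟩
    simpa using hb

/-- The lamplighter group `ℤ/2ℤ ≀ B` over the base group `B`. -/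
abbrev Lamplighter (B : Type*) [Group B] : Type _ :=
  restrictedWreathProduct (Multiplicative (ZMod 2)) B

/-- The Baumslag–Solitar group `BS(m, n) = ⟨a, b ∣ b aᵐ b⁻¹ = aⁿ⟩`, with `a`, `b` the generators
of index `0` and `1`. -/
abbrev BaumslagSolitar (m n : ℤ) : Type :=
  PresentedGroup ({FreeGroup.of 1 * FreeGroup.of 0 ^ m * (FreeGroup.of 1)⁻¹ *
    (FreeGroup.of 0 ^ n)⁻¹} : Set (FreeGroup (Fin 2)))

end

/-!
The base groups `B = D_∞` and `B = BS(1, -1)` both contain an element `t` of infinite order and an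
element `s` with `s t s⁻¹ = t⁻¹`; apart from finite generation, nothing else about them is used
(`hasPositiveEntropyDiscontinuity_of_reflection`).

On the lamplighter group over `B`, consider the walk that at each step randomizes the current lamp
and moves by `t`. It never returns to a lamp, so its position after `n` steps is uniform on `2 ^ n`
elements, and its asymptotic entropy is `log 2`. Perturb it: with probability `ε`, the step is `s`
or `s⁻¹` instead, each with probability `ε / 2`. The asymptotic entropy of the perturbed walk is at
most `H(n) / n` for every `n`, where `H(n)` is the entropy after `n` steps (Fekete's lemma,
`asymptoticEntropy_exists_and_le`). The choice `ε = 1 / (8 m)`, `n = 7 m` gives a uniform gap.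
Conditioning on the sequence of moves costs at most `n` times the entropy of a single move, which is
`o(n)` as `ε → 0` (`shannonEntropy_bind_le`, `shannonEntropy_iidWord_le`); given the moves, the
entropy is at most `log 2` times the number of lamps visited (`shannonEntropy_le_of_isLitWithin`).
That number is at most `n`, and with probability at least `1 / 2048` it is at most `n - m`: a move
`s` in the second of seven blocks of length `m`, a move `s⁻¹` in the fourth block and no other
reflections make the walk turn back and then cover a stretch of its first run again
(`shannonEntropy_reflectedWalk_le`). So the asymptotic entropies of the perturbed walks stay below
`log 2` by a constant, in the limit `ε → 0`.

An independent walk on the free semigroup inside `F₂` adds exactly `log 2` to each of these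
entropies (`shannonEntropy_prodPMF`), which makes those of the perturbed walks positive.
-/

/-! ### Shannon entropy -/

/-- The product measure `p ⊗ q`: the law of an independent pair. -/
noncomputable def prodPMF {α β : Type*} (p : PMF α) (q : PMF β) : PMF (α × β) :=
  p.bind fun a => q.map (Prod.mk a)

theorem prodPMF_apply {α β : Type*} (p : PMF α) (q : PMF β) (a : α) (b : β) :
    prodPMF p q (a, b) = p a * q b := by
  classical
  rw [prodPMF, PMF.bind_apply, tsum_eq_single a]
  · congr 1
    rw [PMF.map_apply, tsum_eq_single b]
    · simp
    · intro b' hb'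
      simp [hb'.symm]
  · intro a' ha'
    rw [PMF.map_apply]
    simp [ha'.symm]

theorem ofReal_negMulLog_mul {x y : ℝ≥0∞} (hx : x ≤ 1) (hy : y ≤ 1) :
    ENNReal.ofReal (Real.negMulLog (x * y).toReal) =
      y * ENNReal.ofReal (Real.negMulLog x.toReal) +
        x * ENNReal.ofReal (Real.negMulLog y.toReal) := by
  have hx' : x ≠ ∞ := ne_top_of_le_ne_top ENNReal.one_ne_top hx
  have hy' : y ≠ ∞ := ne_top_of_le_ne_top ENNReal.one_ne_top hy
  have hx1 : x.toReal ≤ 1 := ENNReal.toReal_le_of_le_ofReal zero_le_one (by simpa using hx)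
  have hy1 : y.toReal ≤ 1 := ENNReal.toReal_le_of_le_ofReal zero_le_one (by simpa using hy)
  have h1 := Real.negMulLog_nonneg ENNReal.toReal_nonneg hx1
  have h2 := Real.negMulLog_nonneg ENNReal.toReal_nonneg hy1
  rw [ENNReal.toReal_mul, Real.negMulLog_mul, ENNReal.ofReal_add (by positivity) (by positivity),
    ENNReal.ofReal_mul (by positivity), ENNReal.ofReal_mul (by positivity),
    ENNReal.ofReal_toReal hx', ENNReal.ofReal_toReal hy']

theorem ofReal_negMulLog_eq {x : ℝ≥0∞} (hx : x ≤ 1) :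
    ENNReal.ofReal (Real.negMulLog x.toReal) = x * ENNReal.ofReal (-Real.log x.toReal) := by
  have hx' : x ≠ ∞ := ne_top_of_le_ne_top ENNReal.one_ne_top hx
  rw [Real.negMulLog, neg_mul_comm, ENNReal.ofReal_mul (by positivity), ENNReal.ofReal_toReal hx']

theorem ofReal_negMulLog_tsum_le {ι : Type*} (f : ι → ℝ≥0∞) (hf : ∑' i, f i ≤ 1) :
    ENNReal.ofReal (Real.negMulLog (∑' i, f i).toReal) ≤
      ∑' i, ENNReal.ofReal (Real.negMulLog (f i).toReal) := by
  have hf' : ∑' i, f i ≠ ∞ := ne_top_of_le_ne_top ENNReal.one_ne_top hf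
  rw [ofReal_negMulLog_eq hf, ← ENNReal.tsum_mul_right]
  refine ENNReal.tsum_le_tsum fun i => ?_
  have hi : f i ≤ ∑' i, f i := ENNReal.le_tsum i
  rw [ofReal_negMulLog_eq (hi.trans hf)]
  rcases eq_or_ne (f i) 0 with h0 | h0
  · simp [h0]
  gcongr
  exact ENNReal.toReal_pos h0 (ne_top_of_le_ne_top hf' hi)

theorem shannonEntropy_pure {α : Type*} (a : α) : shannonEntropy (PMF.pure a) = 0 := by
  classical
  rw [shannonEntropy, ENNReal.tsum_eq_zero]
  intro g
  by_cases h : g = a <;> simp [PMF.pure_apply, h]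

/-- The entropy of a mixture is at most the entropy of the mixing law plus the mean entropy of the
components. -/
theorem shannonEntropy_bind_le {α β : Type*} (p : PMF α) (q : α → PMF β) :
    shannonEntropy (p.bind q) ≤ shannonEntropy p + ∑' a, p a * shannonEntropy (q a) := by
  calc shannonEntropy (p.bind q)
      ≤ ∑' b, ∑' a, ENNReal.ofReal (Real.negMulLog (p a * q a b).toReal) := by
        refine ENNReal.tsum_le_tsum fun b => ?_
        rw [PMF.bind_apply]
        refine ofReal_negMulLog_tsum_le _ ?_
        rw [← PMF.bind_apply]
        exact PMF.coe_le_one _ _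
    _ = ∑' a, ∑' b, (q a b * ENNReal.ofReal (Real.negMulLog (p a).toReal) +
          p a * ENNReal.ofReal (Real.negMulLog (q a b).toReal)) := by
        rw [ENNReal.tsum_comm]
        simp_rw [ofReal_negMulLog_mul (PMF.coe_le_one p _) (PMF.coe_le_one (q _) _)]
    _ = shannonEntropy p + ∑' a, p a * shannonEntropy (q a) := by
        simp_rw [ENNReal.tsum_add, ENNReal.tsum_mul_left, ENNReal.tsum_mul_right, PMF.tsum_coe,
          one_mul]
        rfl

theorem shannonEntropy_map_le {α β : Type*} (p : PMF α) (f : α → β) :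
    shannonEntropy (p.map f) ≤ shannonEntropy p := by
  refine (shannonEntropy_bind_le p (PMF.pure ∘ f)).trans_eq ?_
  simp [shannonEntropy_pure]

theorem map_eq_self_of_eqOn {α : Type*} (p : PMF α) (f : α → α) (hf : ∀ a ∈ p.support, f a = a) :
    p.map f = p := by
  classical
  ext b
  rw [PMF.map_apply]
  rw [tsum_eq_single b]
  · by_cases hb : b ∈ p.support
    · simp [hf b hb]
    · rw [PMF.mem_support_iff, not_not] at hb
      simp [hb]
  · intro a hab
    by_cases ha : a ∈ p.support
    · rw [hf a ha, if_neg hab.symm]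
    · rw [PMF.mem_support_iff, not_not] at ha
      simp [ha]

theorem shannonEntropy_map_of_injOn {α β : Type*} (p : PMF α) (f : α → β)
    (hf : Set.InjOn f p.support) : shannonEntropy (p.map f) = shannonEntropy p := by
  refine (shannonEntropy_map_le p f).antisymm ?_
  have : Nonempty α := ⟨p.support_nonempty.some⟩
  calc shannonEntropy p = shannonEntropy ((p.map f).map (Function.invFunOn f p.support)) := by
        rw [PMF.map_comp, map_eq_self_of_eqOn]
        exact fun a ha => hf.leftInvOn_invFunOn ha
    _ ≤ _ := shannonEntropy_map_le _ _

theorem shannonEntropy_prodPMF {α β : Type*} (p : PMF α) (q : PMF β) :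
    shannonEntropy (prodPMF p q) = shannonEntropy p + shannonEntropy q := by
  rw [shannonEntropy, ENNReal.tsum_prod']
  simp_rw [prodPMF_apply, ofReal_negMulLog_mul (PMF.coe_le_one p _) (PMF.coe_le_one q _),
    ENNReal.tsum_add, ENNReal.tsum_mul_left, ENNReal.tsum_mul_right, PMF.tsum_coe, one_mul]
  rfl

theorem mem_support_prodPMF {α β : Type*} (p : PMF α) (q : PMF β) (x : α × β) :
    x ∈ (prodPMF p q).support ↔ x.1 ∈ p.support ∧ x.2 ∈ q.support := by
  rw [PMF.mem_support_iff, show x = (x.1, x.2) from rfl, prodPMF_apply]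
  simp

theorem shannonEntropy_le_log_card_fintype {α : Type*} [Fintype α] [Nonempty α] (p : PMF α) :
    shannonEntropy p ≤ ENNReal.ofReal (Real.log (Fintype.card α)) := by
  have hN : (0 : ℝ) < Fintype.card α := by exact_mod_cast Fintype.card_pos
  have hp : ∀ a, (p a).toReal ≤ 1 := fun a =>
    ENNReal.toReal_le_of_le_ofReal zero_le_one (by simpa using p.coe_le_one a)
  have hsum : ∑ a, (p a).toReal = 1 := by
    rw [← ENNReal.toReal_sum fun a _ => p.apply_ne_top a, ← tsum_fintype (L := .unconditional _),
      p.tsum_coe, ENNReal.toReal_one]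
  rw [shannonEntropy, tsum_fintype, ← ENNReal.ofReal_sum_of_nonneg fun a _ =>
    Real.negMulLog_nonneg ENNReal.toReal_nonneg (hp a)]
  refine ENNReal.ofReal_le_ofReal ?_
  -- Gibbs' inequality against the uniform law, from `log x ≤ x - 1` at `x = 1 / (N p(a))`.
  have key : ∀ a, Real.negMulLog (p a).toReal ≤
      (p a).toReal * Real.log (Fintype.card α) + ((Fintype.card α : ℝ)⁻¹ - (p a).toReal) := by
    intro a
    rcases (ENNReal.toReal_nonneg (a := p a)).eq_or_lt' with h | h
    · rw [h]; simp
    · have := Real.log_le_sub_one_of_pos (x := ((Fintype.card α : ℝ) * (p a).toReal)⁻¹)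
        (by positivity)
      rw [Real.log_inv, Real.log_mul hN.ne' h.ne'] at this
      have h2 := mul_le_mul_of_nonneg_left this h.le
      have h3 : (p a).toReal * ((Fintype.card α * (p a).toReal)⁻¹ - 1) =
          (Fintype.card α : ℝ)⁻¹ - (p a).toReal := by
        field_simp
      rw [Real.negMulLog]
      linarith
  refine (Finset.sum_le_sum fun a _ => key a).trans_eq ?_
  rw [Finset.sum_add_distrib, Finset.sum_sub_distrib, ← Finset.sum_mul, hsum]
  simp [hN.ne']

/-- The law of a fair coin. -/
noncomputable def fairCoin : PMF Bool := PMF.uniformOfFintype Bool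

theorem shannonEntropy_fairCoin : shannonEntropy fairCoin = ENNReal.ofReal (Real.log 2) := by
  have h : ∀ b, fairCoin b = 2⁻¹ := fun b => by simp [fairCoin]
  rw [shannonEntropy, tsum_fintype]
  simp only [h, Fintype.univ_bool, Finset.mem_singleton, ENNReal.toReal_inv,
    ENNReal.toReal_ofNat, Finset.sum_const, Finset.card_insert_of_notMem, Bool.true_eq_false,
    not_false_eq_true, Finset.card_singleton, Real.negMulLog, Real.log_inv]
  rw [nsmul_eq_mul, show ((1 + 1 : ℕ) : ℝ≥0∞) = ENNReal.ofReal 2 by norm_num,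
    ← ENNReal.ofReal_mul (by norm_num)]
  congr 1
  ring

/-! ### Convolution and asymptotic entropy -/

section Convolution

variable {G H : Type*} [Group G] [Group H]

theorem convolution_eq_map_prodPMF (μ ν : PMF G) :
    convolution μ ν = (prodPMF μ ν).map fun x => x.1 * x.2 := by
  simp [convolution, prodPMF, PMF.map_bind, PMF.map_comp, Function.comp_def]

theorem convolution_pure_one (μ : PMF G) : convolution μ (PMF.pure 1) = μ := by
  simp [convolution, PMF.pure_map]

theorem pure_one_convolution (μ : PMF G) : convolution (PMF.pure 1) μ = μ := by
  simp only [convolution, PMF.pure_bind, one_mul]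
  exact PMF.map_id μ

theorem convolution_assoc (μ ν ρ : PMF G) :
    convolution (convolution μ ν) ρ = convolution μ (convolution ν ρ) := by
  simp [convolution, PMF.map_bind, PMF.map_comp, Function.comp_def, PMF.bind_map, mul_assoc]

theorem convolutionPow_add (μ : PMF G) (m n : ℕ) :
    convolutionPow μ (m + n) = convolution (convolutionPow μ m) (convolutionPow μ n) := by
  induction n with
  | zero => exact (convolution_pure_one _).symm
  | succ n ih => rw [← add_assoc, convolutionPow, ih, convolution_assoc, convolutionPow]

theorem convolutionPow_succ' (μ : PMF G) (n : ℕ) :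
    convolutionPow μ (n + 1) = convolution μ (convolutionPow μ n) := by
  rw [add_comm, convolutionPow_add]
  simp [convolutionPow, pure_one_convolution]

theorem mem_support_convolution (μ ν : PMF G) (g : G) :
    g ∈ (convolution μ ν).support ↔ ∃ x ∈ μ.support, ∃ y ∈ ν.support, x * y = g := by
  simp only [convolution, PMF.mem_support_bind_iff, PMF.mem_support_map_iff]

theorem shannonEntropy_convolution_le (μ ν : PMF G) :
    shannonEntropy (convolution μ ν) ≤ shannonEntropy μ + shannonEntropy ν := by
  rw [convolution_eq_map_prodPMF, ← shannonEntropy_prodPMF]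
  exact shannonEntropy_map_le _ _

theorem shannonEntropy_convolutionPow_le (μ : PMF G) (n : ℕ) :
    shannonEntropy (convolutionPow μ n) ≤ n * shannonEntropy μ := by
  induction n with
  | zero => simp [convolutionPow, shannonEntropy_pure]
  | succ n ih =>
    rw [convolutionPow]
    refine (shannonEntropy_convolution_le _ _).trans ?_
    push_cast
    rw [add_mul, one_mul]
    gcongr

/-- If the last increment of the walk can be read off from its position, then the entropy of the
walk grows linearly. -/
theorem shannonEntropy_convolutionPow_of_decodable (μ : PMF G)
    (h : ∀ n, ∀ x ∈ (convolutionPow μ n).support, ∀ y ∈ (convolutionPow μ n).support,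
      ∀ a ∈ μ.support, ∀ b ∈ μ.support, x * a = y * b → a = b) (n : ℕ) :
    shannonEntropy (convolutionPow μ n) = n * shannonEntropy μ := by
  induction n with
  | zero => simp [convolutionPow, shannonEntropy_pure]
  | succ n ih =>
    rw [convolutionPow, convolution_eq_map_prodPMF, shannonEntropy_map_of_injOn,
      shannonEntropy_prodPMF, ih]
    · push_cast
      rw [add_mul, one_mul]
    · rintro ⟨x, a⟩ hx ⟨y, b⟩ hy hxy
      rw [mem_support_prodPMF] at hx hy
      obtain rfl := h n x hx.1 y hy.1 a hx.2 b hy.2 hxy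
      simpa using hxy

theorem convolutionPow_map (φ : G →* H) (μ : PMF G) (n : ℕ) :
    convolutionPow (μ.map φ) n = (convolutionPow μ n).map φ := by
  induction n with
  | zero => simp [convolutionPow, PMF.pure_map]
  | succ n ih =>
    simp [convolutionPow, ih, convolution, PMF.map_bind, PMF.map_comp, PMF.bind_map,
      Function.comp_def]

theorem convolution_prodPMF (μ μ' : PMF G) (ν ν' : PMF H) :
    convolution (prodPMF μ ν) (prodPMF μ' ν') =
      prodPMF (convolution μ μ') (convolution ν ν') := by
  simp only [convolution, prodPMF, PMF.map_bind, PMF.map_comp, PMF.bind_map, Function.comp_def,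
    PMF.bind_bind, Prod.mk_mul_mk]
  refine congrArg _ (funext fun x => ?_)
  rw [PMF.bind_comm]

theorem convolutionPow_prodPMF (μ : PMF G) (ν : PMF H) (n : ℕ) :
    convolutionPow (prodPMF μ ν) n = prodPMF (convolutionPow μ n) (convolutionPow ν n) := by
  induction n with
  | zero => simp [convolutionPow, prodPMF, PMF.pure_map, Prod.one_eq_mk]
  | succ n ih => rw [convolutionPow, ih, convolution_prodPMF]; rfl

theorem asymptoticEntropyExists_of_tendsto {μ : PMF G} {c : ℝ≥0∞}
    (h : Tendsto (fun n : ℕ => shannonEntropy (convolutionPow μ n) / (n : ℝ≥0∞)) atTop (𝓝 c)) :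
    AsymptoticEntropyExists μ ∧ asymptoticEntropy μ = c := by
  have : asymptoticEntropy μ = c := h.limUnder_eq
  exact ⟨by rw [AsymptoticEntropyExists, this]; exact h, this⟩

/-- Fekete's lemma for the entropy of a random walk whose increments have finite entropy. -/
theorem asymptoticEntropy_exists_and_le {μ : PMF G} (hμ : shannonEntropy μ ≠ ∞) :
    AsymptoticEntropyExists μ ∧ ∀ n : ℕ, n ≠ 0 →
      asymptoticEntropy μ ≤ shannonEntropy (convolutionPow μ n) / n := by
  have hfin : ∀ n, shannonEntropy (convolutionPow μ n) ≠ ∞ := fun n =>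
    ne_top_of_le_ne_top (ENNReal.mul_ne_top (ENNReal.natCast_ne_top n) hμ)
      (shannonEntropy_convolutionPow_le μ n)
  set u : ℕ → ℝ := fun n => (shannonEntropy (convolutionPow μ n)).toReal with hu
  have hsub : Subadditive u := by
    intro m n
    rw [hu]
    dsimp only
    rw [← ENNReal.toReal_add (hfin m) (hfin n), convolutionPow_add]
    exact ENNReal.toReal_mono (ENNReal.add_ne_top.2 ⟨hfin m, hfin n⟩)
      (shannonEntropy_convolution_le _ _)
  have hbdd : BddBelow (Set.range fun n => u n / n) := by
    refine ⟨0, ?_⟩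
    rintro _ ⟨n, rfl⟩
    exact div_nonneg ENNReal.toReal_nonneg (Nat.cast_nonneg n)
  have hdiv : ∀ n : ℕ, n ≠ 0 →
      ENNReal.ofReal (u n / n) = shannonEntropy (convolutionPow μ n) / n := by
    intro n hn
    rw [ENNReal.ofReal_div_of_pos (by positivity), ENNReal.ofReal_toReal (hfin n),
      ENNReal.ofReal_natCast]
  have hlim := asymptoticEntropyExists_of_tendsto (μ := μ) (c := ENNReal.ofReal hsub.lim) <| by
    refine ((ENNReal.continuous_ofReal.tendsto _).comp (hsub.tendsto_lim hbdd)).congr' ?_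
    filter_upwards [eventually_ne_atTop 0] with n hn using hdiv n hn
  refine ⟨hlim.1, fun n hn => ?_⟩
  rw [hlim.2, ← hdiv n hn]
  exact ENNReal.ofReal_le_ofReal (hsub.lim_le_div hbdd hn)

end Convolution

/-! ### Random words -/

section Words

variable {I G : Type*} [Group G]

/-- The law of a word of `n` independent letters of law `π`. -/
noncomputable def iidWord (π : PMF I) : ℕ → PMF (List I)
  | 0 => PMF.pure []
  | n + 1 => π.bind fun i => (iidWord π n).map (List.cons i)

/-- The convolution product of the measures `κ i`, along the letters `i` of a word. -/
noncomputable def wordLaw (κ : I → PMF G) : List I → PMF G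
  | [] => PMF.pure 1
  | i :: w => convolution (κ i) (wordLaw κ w)

theorem convolutionPow_bind (π : PMF I) (κ : I → PMF G) (n : ℕ) :
    convolutionPow (π.bind κ) n = (iidWord π n).bind (wordLaw κ) := by
  induction n with
  | zero => simp [convolutionPow, iidWord, wordLaw]
  | succ n ih =>
    rw [convolutionPow_succ', ih]
    simp only [iidWord, convolution, PMF.bind_bind, PMF.bind_map, PMF.map_bind, Function.comp_def,
      wordLaw]
    refine congrArg _ (funext fun i => ?_)
    rw [PMF.bind_comm]

theorem shannonEntropy_iidWord_le (π : PMF I) (n : ℕ) :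
    shannonEntropy (iidWord π n) ≤ n * shannonEntropy π := by
  induction n with
  | zero => simp [iidWord, shannonEntropy_pure]
  | succ n ih =>
    calc shannonEntropy (iidWord π (n + 1))
        ≤ shannonEntropy π + ∑' i, π i * shannonEntropy ((iidWord π n).map (List.cons i)) :=
          shannonEntropy_bind_le _ _
      _ ≤ shannonEntropy π + ∑' i, π i * (n * shannonEntropy π) := by
          gcongr
          exact (shannonEntropy_map_le _ _).trans ih
      _ = _ := by
          rw [ENNReal.tsum_mul_right, PMF.tsum_coe]
          push_cast
          ring

theorem length_of_mem_support_iidWord (π : PMF I) (n : ℕ) (w : List I)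
    (hw : w ∈ (iidWord π n).support) : w.length = n := by
  induction n generalizing w with
  | zero => simpa [iidWord] using hw
  | succ n ih =>
    simp only [iidWord, PMF.mem_support_bind_iff, PMF.mem_support_map_iff] at hw
    obtain ⟨i, -, v, hv, rfl⟩ := hw
    simp [ih v hv]

theorem prod_le_iidWord (π : PMF I) (w : List I) :
    (w.map π).prod ≤ iidWord π w.length w := by
  classical
  induction w with
  | nil => simp [iidWord]
  | cons i w ih =>
    rw [List.map_cons, List.prod_cons, List.length_cons, iidWord, PMF.bind_apply]
    refine le_trans ?_ (ENNReal.le_tsum i)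
    gcongr
    rw [PMF.map_apply]
    refine ih.trans (le_trans ?_ (ENNReal.le_tsum w))
    simp

theorem shannonEntropy_wordLaw_le (κ : I → PMF G) {c : ℝ≥0∞} (hc : ∀ i, shannonEntropy (κ i) ≤ c)
    (w : List I) : shannonEntropy (wordLaw κ w) ≤ w.length * c := by
  induction w with
  | nil => simp [wordLaw, shannonEntropy_pure]
  | cons i w ih =>
    refine (shannonEntropy_convolution_le _ _).trans ?_
    rw [List.length_cons, Nat.cast_succ, add_mul, one_mul, add_comm]
    gcongr
    exact hc i

/-- If every letter has entropy at most `c`, and the words in `S` fall short of the resulting bound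
`n c` by at least `d`, then so does the `n`-step walk, up to the entropy of the letters, by at least
`d` times the probability of `S`. -/
theorem shannonEntropy_convolutionPow_bind_add_le (π : PMF I) (κ : I → PMF G) {c d : ℝ≥0∞}
    (hc : ∀ i, shannonEntropy (κ i) ≤ c) (n : ℕ) (S : Finset (List I))
    (hS : ∀ w ∈ S, shannonEntropy (wordLaw κ w) + d ≤ n * c) :
    shannonEntropy (convolutionPow (π.bind κ) n) + (∑ w ∈ S, iidWord π n w) * d ≤
      n * shannonEntropy π + n * c := by
  classical
  have hsplit : (∑ w ∈ S, iidWord π n w) * d = ∑' w, iidWord π n w * (if w ∈ S then d else 0) := by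
    rw [tsum_eq_sum (s := S) (fun w hw => by simp [hw]), Finset.sum_mul]
    exact Finset.sum_congr rfl fun w hw => by simp [hw]
  calc shannonEntropy (convolutionPow (π.bind κ) n) + (∑ w ∈ S, iidWord π n w) * d
      ≤ (shannonEntropy (iidWord π n) + ∑' w, iidWord π n w * shannonEntropy (wordLaw κ w)) +
          ∑' w, iidWord π n w * (if w ∈ S then d else 0) := by
        rw [convolutionPow_bind, hsplit]
        gcongr
        exact shannonEntropy_bind_le _ _
    _ = shannonEntropy (iidWord π n) + ∑' w, iidWord π n w *
          (shannonEntropy (wordLaw κ w) + if w ∈ S then d else 0) := by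
        rw [add_assoc, ← ENNReal.tsum_add]
        simp_rw [mul_add]
    _ ≤ n * shannonEntropy π + ∑' w, iidWord π n w * (n * c) := by
        refine add_le_add (shannonEntropy_iidWord_le π n) (ENNReal.tsum_le_tsum fun w => ?_)
        by_cases hw : w ∈ (iidWord π n).support
        · gcongr
          split_ifs with hwS
          · exact hS w hwS
          · rw [add_zero, ← length_of_mem_support_iidWord π n w hw]
            exact shannonEntropy_wordLaw_le κ hc w
        · rw [PMF.mem_support_iff, not_not] at hw
          simp [hw]
    _ = _ := by rw [ENNReal.tsum_mul_right, PMF.tsum_coe, one_mul]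

end Words

/-! ### Lamplighter groups -/

section Lamplighter

variable {B : Type*} [Group B]

open Classical in
/-- The element of the lamplighter group that switches the lamp at the identity if `c` is true, and
then moves the lamplighter by `b`. -/
noncomputable def switchMove (c : Bool) (b : B) : Lamplighter B :=
  ⟨⟨Pi.mulSingle 1 (if c then Multiplicative.ofAdd (1 : ZMod 2) else 1), b⟩,
    (Set.finite_singleton 1).subset Pi.mulSupport_mulSingle_subset⟩

@[simp]
theorem switchMove_right (c : Bool) (b : B) : (switchMove c b).1.right = b := rfl

open Classical in
theorem switchMove_left (c : Bool) (b : B) : (switchMove c b).1.left =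
    (Pi.mulSingle 1 (if c then Multiplicative.ofAdd (1 : ZMod 2) else 1) :
      B → Multiplicative (ZMod 2)) := rfl

theorem switchMove_injective (b : B) : Function.Injective (fun c => switchMove c b) := by
  intro c d h
  have h1 := congrArg (fun g : Lamplighter B => g.1.left 1) h
  simp only [switchMove_left, Pi.mulSingle_eq_same] at h1
  revert h1
  cases c <;> cases d <;> decide

theorem lamplighter_mul_left (x y : Lamplighter B) (b : B) :
    (x * y).1.left b = x.1.left b * y.1.left (x.1.right⁻¹ * b) := rfl

theorem lamplighter_mul_right (x y : Lamplighter B) :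
    (x * y).1.right = x.1.right * y.1.right := rfl

theorem lamplighter_ext {x y : Lamplighter B} (h : ∀ b, x.1.left b = y.1.left b)
    (h' : x.1.right = y.1.right) : x = y :=
  Subtype.ext (RegularWreathProduct.ext (funext h) h')

/-- Under the law `p`, the lamplighter ends at `b`, and all lit lamps lie in `V`. -/
def IsLitWithin (p : PMF (Lamplighter B)) (V : Finset B) (b : B) : Prop :=
  ∀ g ∈ p.support, g.1.right = b ∧ ∀ x ∉ V, g.1.left x = 1

theorem shannonEntropy_le_of_isLitWithin {p : PMF (Lamplighter B)} {V : Finset B} {b : B}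
    (h : IsLitWithin p V b) : shannonEntropy p ≤ V.card * ENNReal.ofReal (Real.log 2) := by
  classical
  let f : Lamplighter B → (V → Multiplicative (ZMod 2)) := fun g v => g.1.left v
  have hf : Set.InjOn f p.support := by
    intro x hx y hy hxy
    refine lamplighter_ext (fun v => ?_) ((h x hx).1.trans (h y hy).1.symm)
    by_cases hv : v ∈ V
    · exact congrFun hxy ⟨v, hv⟩
    · rw [(h x hx).2 v hv, (h y hy).2 v hv]
  rw [← shannonEntropy_map_of_injOn p f hf]
  refine (shannonEntropy_le_log_card_fintype _).trans_eq ?_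
  rw [Fintype.card_fun, Fintype.card_multiplicative, ZMod.card, Fintype.card_coe]
  push_cast
  rw [Real.log_pow, ENNReal.ofReal_mul (by positivity), ENNReal.ofReal_natCast]

theorem IsLitWithin.convolution [DecidableEq B] {p q : PMF (Lamplighter B)} {V W : Finset B}
    {b c : B} (hp : IsLitWithin p V b) (hq : IsLitWithin q W c) :
    IsLitWithin (convolution p q) (V ∪ W.image (b * ·)) (b * c) := by
  intro g hg
  obtain ⟨x, hx, y, hy, rfl⟩ := (mem_support_convolution p q g).1 hg
  refine ⟨by rw [lamplighter_mul_right, (hp x hx).1, (hq y hy).1], fun z hz => ?_⟩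
  rw [Finset.mem_union, not_or] at hz
  rw [lamplighter_mul_left, (hp x hx).2 z hz.1, (hp x hx).1, (hq y hy).2, one_mul]
  intro hzW
  exact hz.2 (Finset.mem_image.2 ⟨_, hzW, by simp⟩)

/-- The law of the increment that randomizes the current lamp and then moves by `t`. -/
noncomputable def switchStep (t : B) : PMF (Lamplighter B) :=
  fairCoin.map fun c => switchMove c t

theorem shannonEntropy_switchStep (t : B) :
    shannonEntropy (switchStep t) = ENNReal.ofReal (Real.log 2) := by
  rw [switchStep, shannonEntropy_map_of_injOn _ _ (switchMove_injective t).injOn,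
    shannonEntropy_fairCoin]

theorem mem_support_switchStep {t : B} {g : Lamplighter B} :
    g ∈ (switchStep t).support ↔ ∃ c, switchMove c t = g := by
  simp [switchStep, fairCoin]

theorem isLitWithin_switchStep (t : B) : IsLitWithin (switchStep t) {1} t := by
  classical
  intro g hg
  obtain ⟨c, rfl⟩ := mem_support_switchStep.1 hg
  refine ⟨rfl, fun x hx => ?_⟩
  rw [switchMove_left, Pi.mulSingle_eq_of_ne (by simpa using hx)]

theorem isLitWithin_pure (b : B) : IsLitWithin (PMF.pure (switchMove false b)) ∅ b := by
  intro g hg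
  obtain rfl := (PMF.mem_support_pure_iff _ _).1 hg
  exact ⟨rfl, fun x _ => by simp [switchMove_left]⟩

theorem isLitWithin_convolutionPow_switchStep [DecidableEq B] (t : B) (n : ℕ) :
    IsLitWithin (convolutionPow (switchStep t) n) ((Finset.range n).image (t ^ ·)) (t ^ n) := by
  induction n with
  | zero =>
    intro g hg
    obtain rfl := (PMF.mem_support_pure_iff _ _).1 hg
    exact ⟨(pow_zero t).symm, fun x _ => rfl⟩
  | succ n ih =>
    have := ih.convolution (isLitWithin_switchStep t)
    rw [Finset.image_singleton, mul_one] at this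
    rwa [convolutionPow, pow_succ, Finset.range_add_one, Finset.image_insert, Finset.insert_eq,
      Finset.union_comm]

/-- When `t` has infinite order, every move by `t` leaves a lamp behind that is never switched
again, so that the lamplighter group element remembers the state of its last lamp. -/
theorem switchStep_decodable {t : B} (ht : ∀ n : ℕ, n ≠ 0 → t ^ n ≠ 1) (n : ℕ)
    (x : Lamplighter B) (hx : x ∈ (convolutionPow (switchStep t) n).support)
    (y : Lamplighter B) (hy : y ∈ (convolutionPow (switchStep t) n).support)
    (a : Lamplighter B) (ha : a ∈ (switchStep t).support)
    (b : Lamplighter B) (hb : b ∈ (switchStep t).support) (h : x * a = y * b) : a = b := by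
  classical
  have hlit := isLitWithin_convolutionPow_switchStep t n
  have hmem : t ^ n ∉ (Finset.range n).image (t ^ ·) := by
    rw [Finset.mem_image]
    rintro ⟨m, hm, hmn⟩
    rw [Finset.mem_range] at hm
    refine ht (n - m) (by omega) ?_
    have hmn' : t ^ m = t ^ n := hmn
    have : t ^ m * t ^ (n - m) = t ^ n := by rw [← pow_add]; congr 1; omega
    rwa [← hmn', mul_eq_left] at this
  obtain ⟨c, rfl⟩ := mem_support_switchStep.1 ha
  obtain ⟨d, rfl⟩ := mem_support_switchStep.1 hb
  have h1 := congrArg (fun g : Lamplighter B => g.1.left (t ^ n)) h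
  simp only [lamplighter_mul_left] at h1
  rw [(hlit x hx).2 _ hmem, (hlit y hy).2 _ hmem, (hlit x hx).1, (hlit y hy).1, inv_mul_cancel,
    one_mul, one_mul] at h1
  refine lamplighter_ext (fun z => ?_) rfl
  rw [switchMove_left, switchMove_left, Pi.mulSingle_eq_same, Pi.mulSingle_eq_same] at h1
  rw [switchMove_left, switchMove_left, h1]

theorem shannonEntropy_convolutionPow_switchStep {t : B} (ht : ∀ n : ℕ, n ≠ 0 → t ^ n ≠ 1)
    (n : ℕ) : shannonEntropy (convolutionPow (switchStep t) n) =
      n * ENNReal.ofReal (Real.log 2) := by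
  rw [shannonEntropy_convolutionPow_of_decodable _ (switchStep_decodable ht),
    shannonEntropy_switchStep]

/-- The embedding of the base group into the lamplighter group. -/
noncomputable def lamplighterBase : B →* Lamplighter B where
  toFun := switchMove false
  map_one' := lamplighter_ext (fun b => by simp [switchMove_left]) rfl
  map_mul' x y := lamplighter_ext
    (fun b => by simp [switchMove_left]) rfl

theorem lamplighterBase_left (b x : B) : (lamplighterBase b).1.left x = 1 := by
  change (switchMove false b).1.left x = 1
  simp [switchMove_left]

theorem lamplighterBase_right (b : B) : (lamplighterBase b).1.right = b := rfl

/-- The base group and the switch at the identity generate the lamplighter group, since the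
conjugates of the switch generate all finitely supported lamp configurations. -/
theorem mem_of_lamplighterBase_mem (K : Subgroup (Lamplighter B))
    (hbase : ∀ b, lamplighterBase b ∈ K) (hswitch : switchMove true 1 ∈ K) (V : Finset B)
    (x : Lamplighter B) (hx : ∀ b ∉ V, x.1.left b = 1) : x ∈ K := by
  classical
  induction V using Finset.induction_on generalizing x with
  | empty =>
    have : x = lamplighterBase x.1.right :=
      lamplighter_ext (fun b => by rw [hx b (Finset.notMem_empty b), lamplighterBase_left])
        (lamplighterBase_right _).symm
    rw [this]
    exact hbase _
  | insert v V hv ih =>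
    by_cases hxv : x.1.left v = 1
    · refine ih x fun b hb => ?_
      by_cases hbv : b = v
      · rwa [hbv]
      · exact hx b (by simp [hb, hbv])
    · set c : Lamplighter B := lamplighterBase v * switchMove true 1 * lamplighterBase v⁻¹ with hc
      have hcK : c ∈ K := K.mul_mem (K.mul_mem (hbase _) hswitch) (hbase _)
      rw [← K.mul_mem_cancel_left hcK]
      have hcr : c.1.right = 1 := by
        simp [hc, lamplighterBase_right]
      have hcl : ∀ b, c.1.left b = (Pi.mulSingle v (Multiplicative.ofAdd (1 : ZMod 2)) :
          B → Multiplicative (ZMod 2)) b := by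
        intro b
        simp only [hc, lamplighter_mul_left, lamplighterBase_left, one_mul, mul_one,
          lamplighterBase_right, switchMove_left, if_true]
        by_cases hbv : b = v
        · subst hbv
          rw [inv_mul_cancel, Pi.mulSingle_eq_same, Pi.mulSingle_eq_same]
        · rw [Pi.mulSingle_eq_of_ne hbv, Pi.mulSingle_eq_of_ne]
          rwa [ne_eq, inv_mul_eq_one, eq_comm]
      refine ih _ fun b hb => ?_
      rw [lamplighter_mul_left, hcr, hcl, inv_one, one_mul]
      by_cases hbv : b = v
      · subst hbv
        rw [Pi.mulSingle_eq_same]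
        have : ∀ y : Multiplicative (ZMod 2), y ≠ 1 → Multiplicative.ofAdd (1 : ZMod 2) * y = 1 := by
          decide
        exact this _ hxv
      · rw [Pi.mulSingle_eq_of_ne hbv, one_mul]
        exact hx b (by simp [hb, hbv])

theorem lamplighter_fg [Group.FG B] : Group.FG (Lamplighter B) := by
  obtain ⟨S, hS, hfin⟩ := Group.fg_iff.1 (inferInstance : Group.FG B)
  refine Group.fg_iff.2 ⟨lamplighterBase '' S ∪ {switchMove true 1}, ?_,
    (hfin.image _).union (Set.finite_singleton _)⟩
  rw [eq_top_iff]
  intro x _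
  refine mem_of_lamplighterBase_mem _ (fun b => ?_)
    (Subgroup.subset_closure (Or.inr rfl)) x.2.toFinset x (fun b hb => ?_)
  · have : lamplighterBase b ∈ (Subgroup.closure S).map lamplighterBase :=
      ⟨b, by rw [hS]; trivial, rfl⟩
    rw [MonoidHom.map_closure] at this
    exact Subgroup.closure_mono Set.subset_union_left this
  · by_contra h
    exact hb ((Set.Finite.mem_toFinset _).2 h)

end Lamplighter

/-! ### Rare reflections -/

section Excursion

/-- The word with letters `none` (an ordinary step), `some true` and `some false` (a reflection and
its inverse) that makes `i` ordinary steps, a reflection, `j` ordinary steps, the inverse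
reflection, and `l` ordinary steps. -/
def excursionWord (i j l : ℕ) : List (Option Bool) :=
  List.replicate i none ++ some true :: (List.replicate j none ++ some false ::
    List.replicate l none)

theorem length_excursionWord (i j l : ℕ) : (excursionWord i j l).length = i + j + l + 2 := by
  simp [excursionWord]
  omega

theorem replicate_append_cons_inj {α : Type*} {x y : α} (hxy : x ≠ y) {i i' : ℕ} {u u' : List α}
    (h : List.replicate i x ++ y :: u = List.replicate i' x ++ y :: u') : i = i' ∧ u = u' := by
  induction i generalizing i' with
  | zero =>
    cases i' with
    | zero => simpa using h
    | succ i' => exact absurd (by simpa [List.replicate_succ] using h : y = x ∧ _).1 hxy.symm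
  | succ i ih =>
    cases i' with
    | zero => exact absurd (by simpa [List.replicate_succ] using h : x = y ∧ _).1 hxy
    | succ i' => simpa using ih (by simpa [List.replicate_succ] using h)

theorem excursionWord_inj {i j l i' j' l' : ℕ} (h : excursionWord i j l = excursionWord i' j' l') :
    i = i' ∧ j = j' := by
  obtain ⟨h1, h2⟩ := replicate_append_cons_inj (by simp) h
  exact ⟨h1, (replicate_append_cons_inj (by simp) h2).1⟩

variable {B : Type*} [Group B]

/-- The increments of the perturbed lamplighter walk: `none` randomizes the current lamp and moves
by `t`; the other letters move by `s` and by `s⁻¹`, leaving the lamps alone. -/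
noncomputable def stepLaw (t s : B) : Option Bool → PMF (Lamplighter B)
  | none => switchStep t
  | some c => PMF.pure (switchMove false (if c then s else s⁻¹))

theorem shannonEntropy_stepLaw_le (t s : B) (i : Option Bool) :
    shannonEntropy (stepLaw t s i) ≤ ENNReal.ofReal (Real.log 2) := by
  cases i with
  | none => exact (shannonEntropy_switchStep t).le
  | some c => simp [stepLaw, shannonEntropy_pure]

theorem wordLaw_replicate_append {I G : Type*} [Group G] (κ : I → PMF G) (i : ℕ) (x : I)
    (w : List I) : wordLaw κ (List.replicate i x ++ w) =
      convolution (convolutionPow (κ x) i) (wordLaw κ w) := by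
  induction i with
  | zero => simp [convolutionPow, pure_one_convolution]
  | succ i ih =>
    rw [List.replicate_succ, List.cons_append, wordLaw, ih, convolutionPow_succ',
      convolution_assoc]

theorem wordLaw_excursionWord (t s : B) (i j l : ℕ) :
    wordLaw (stepLaw t s) (excursionWord i j l) =
      convolution (convolutionPow (switchStep t) i)
        (convolution (PMF.pure (switchMove false s))
          (convolution (convolutionPow (switchStep t) j)
            (convolution (PMF.pure (switchMove false s⁻¹))
              (convolutionPow (switchStep t) l)))) := by
  have h : List.replicate l (none : Option Bool) = List.replicate l none ++ [] := by simp
  rw [excursionWord, wordLaw_replicate_append, wordLaw, wordLaw_replicate_append, wordLaw, h,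
    wordLaw_replicate_append, wordLaw, convolution_pure_one]
  simp [stepLaw]

theorem IsLitWithin.mono {p : PMF (Lamplighter B)} {V W : Finset B} {b : B}
    (h : IsLitWithin p V b) (hVW : V ⊆ W) : IsLitWithin p W b :=
  fun g hg => ⟨(h g hg).1, fun x hx => (h g hg).2 x fun hxV => hx (hVW hxV)⟩

/-- On an excursion, the first and the third run of ordinary steps visit the sites `t ^ n` with
`0 ≤ n < i` and with `i - j ≤ n < i - j + l`. -/
theorem shannonEntropy_excursionWord_le {t s : B} (hst : s * t * s⁻¹ = t⁻¹) {i j l N : ℕ}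
    (hN : max (i : ℤ) (i - j + l) - min 0 ((i : ℤ) - j) + j ≤ N) :
    shannonEntropy (wordLaw (stepLaw t s) (excursionWord i j l)) ≤
      N * ENNReal.ofReal (Real.log 2) := by
  classical
  have hrun := isLitWithin_convolutionPow_switchStep t
  have hlit := (hrun i).convolution ((isLitWithin_pure s).convolution ((hrun j).convolution
    ((isLitWithin_pure s⁻¹).convolution (hrun l))))
  rw [← wordLaw_excursionWord] at hlit
  set V₁ : Finset B := (Finset.Ico (min 0 ((i : ℤ) - j)) (max (i : ℤ) (i - j + l))).image (t ^ ·)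
    with hV₁
  set V₂ : Finset B := (Finset.range j).image fun m => t ^ i * (s * t ^ m) with hV₂
  have hsub := hlit.mono (W := V₁ ∪ V₂) <| by
    intro x hx
    simp only [Finset.mem_union, Finset.mem_image, Finset.mem_range, Finset.notMem_empty,
      false_or, exists_exists_and_eq_and] at hx
    simp only [Finset.mem_union, hV₁, hV₂, Finset.mem_image, Finset.mem_range, Finset.mem_Ico]
    rcases hx with ⟨m, hm, rfl⟩ | ⟨y, ⟨m, hm, rfl⟩ | ⟨m, hm, rfl⟩, rfl⟩
    · exact Or.inl ⟨m, by omega, by simp⟩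
    · exact Or.inr ⟨m, hm, rfl⟩
    · refine Or.inl ⟨i - j + m, by omega, ?_⟩
      have hj : s * t ^ j * s⁻¹ = (t ^ j)⁻¹ := by rw [← conj_pow, hst, inv_pow]
      rw [← mul_assoc s, ← mul_assoc (s * _), hj, zpow_add, zpow_sub]
      simp [mul_assoc]
  refine (shannonEntropy_le_of_isLitWithin hsub).trans ?_
  gcongr
  have h1 : V₁.card ≤ _ := Finset.card_image_le
  have h2 : V₂.card ≤ _ := Finset.card_image_le
  rw [Int.card_Ico] at h1
  rw [Finset.card_range] at h2
  have h3 := Finset.card_union_le V₁ V₂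
  omega

/-- The law of the letters: a reflection or its inverse, with probability `ε / 2` each, and an
ordinary step otherwise. -/
noncomputable def flipLaw (ε : ℝ) (h0 : 0 ≤ ε) (h1 : ε ≤ 1) : PMF (Option Bool) :=
  PMF.ofFintype (fun i => i.elim (ENNReal.ofReal (1 - ε)) fun _ => ENNReal.ofReal (ε / 2)) <| by
    rw [Fintype.sum_option, Fintype.sum_bool]
    simp only [Option.elim]
    rw [← ENNReal.ofReal_add (by linarith) (by linarith),
      ← ENNReal.ofReal_add (by linarith) (by linarith), ← ENNReal.ofReal_one]
    congr 1
    ring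

theorem flipLaw_none (ε : ℝ) (h0 : 0 ≤ ε) (h1 : ε ≤ 1) :
    flipLaw ε h0 h1 none = ENNReal.ofReal (1 - ε) := rfl

theorem flipLaw_some (ε : ℝ) (h0 : 0 ≤ ε) (h1 : ε ≤ 1) (c : Bool) :
    flipLaw ε h0 h1 (some c) = ENNReal.ofReal (ε / 2) := rfl

theorem tendsto_flipLaw (ε : ℕ → ℝ) (h0 : ∀ k, 0 ≤ ε k) (h1 : ∀ k, ε k ≤ 1)
    (h : Tendsto ε atTop (𝓝 0)) (i : Option Bool) :
    Tendsto (fun k => flipLaw (ε k) (h0 k) (h1 k) i) atTop (𝓝 (PMF.pure none i)) := by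
  cases i with
  | none =>
    simp only [flipLaw_none, PMF.pure_apply_self]
    have := ENNReal.tendsto_ofReal (h.const_sub 1)
    simpa using this
  | some c =>
    simp only [flipLaw_some]
    rw [PMF.pure_apply_of_ne _ _ (by simp)]
    have := ENNReal.tendsto_ofReal (h.div_const 2)
    simpa using this

theorem tendsto_shannonEntropy {α : Type*} [Fintype α] {p : ℕ → PMF α} {q : PMF α}
    (h : ∀ a, Tendsto (fun k => p k a) atTop (𝓝 (q a))) :
    Tendsto (fun k => shannonEntropy (p k)) atTop (𝓝 (shannonEntropy q)) := by
  simp only [shannonEntropy, tsum_fintype]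
  refine tendsto_finsetSum _ fun a _ => ENNReal.tendsto_ofReal ?_
  exact (Real.continuous_negMulLog.tendsto _).comp
    ((ENNReal.tendsto_toReal (q.apply_ne_top a)).comp (h a))

theorem tendsto_bind {α β : Type*} [Fintype α] {p : ℕ → PMF α} {q : PMF α} (f : α → PMF β)
    (h : ∀ a, Tendsto (fun k => p k a) atTop (𝓝 (q a))) (b : β) :
    Tendsto (fun k => (p k).bind f b) atTop (𝓝 (q.bind f b)) := by
  simp only [PMF.bind_apply, tsum_fintype]
  exact tendsto_finsetSum _ fun a _ =>
    ENNReal.Tendsto.mul_const (h a) (Or.inr ((f a).apply_ne_top b))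

theorem le_iidWord_excursionWord {m : ℕ} (hm : 0 < m) {ε : ℝ} (hε : ε = 1 / (8 * m)) (h0 : 0 ≤ ε)
    (h1 : ε ≤ 1) {i j l : ℕ} (hlen : i + j + l + 2 = 7 * m) :
    ENNReal.ofReal (1 / (2048 * m ^ 2)) ≤
      iidWord (flipLaw ε h0 h1) (7 * m) (excursionWord i j l) := by
  have hm' : (0 : ℝ) < m := by exact_mod_cast hm
  have hw := prod_le_iidWord (flipLaw ε h0 h1) (excursionWord i j l)
  rw [length_excursionWord, hlen] at hw
  refine le_trans ?_ hw
  simp only [excursionWord, List.map_append, List.map_replicate, List.map_cons, List.prod_append,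
    List.prod_replicate, List.prod_cons, flipLaw_none, flipLaw_some]
  rw [← ENNReal.ofReal_pow (by linarith), ← ENNReal.ofReal_pow (by linarith),
    ← ENNReal.ofReal_pow (by linarith), ← ENNReal.ofReal_mul (by positivity),
    ← ENNReal.ofReal_mul (pow_nonneg (by linarith) _), ← ENNReal.ofReal_mul (by positivity),
    ← ENNReal.ofReal_mul (pow_nonneg (by linarith) _)]
  refine ENNReal.ofReal_le_ofReal ?_
  -- Bernoulli's inequality: the `i + j + l < 7 m` ordinary letters have probability
  -- `(1 - ε) ^ (i + j + l) ≥ 1 - 7 m ε = 1 / 8`.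
  have hbern : (1 : ℝ) / 8 ≤ (1 - ε) ^ (i + j + l) := by
    have hb := one_add_mul_le_pow (a := -ε) (by linarith) (i + j + l)
    have hle : ((i + j + l : ℕ) : ℝ) ≤ 7 * m := by exact_mod_cast (by omega : i + j + l ≤ 7 * m)
    have hmul : ((i + j + l : ℕ) : ℝ) * ε ≤ 7 * m * ε := by gcongr
    have h7 : 7 * m * ε = 7 / 8 := by rw [hε]; field_simp
    rw [← sub_eq_add_neg] at hb
    linarith
  calc (1 : ℝ) / (2048 * m ^ 2) = 1 / 8 * (ε / 2 * (ε / 2)) := by rw [hε]; field_simp; norm_num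
    _ ≤ (1 - ε) ^ (i + j + l) * (ε / 2 * (ε / 2)) := by gcongr
    _ = _ := by rw [pow_add, pow_add]; ring

/-- With reflections at rate `1 / (8 m)`, the walk of `7 m` steps makes, with probability at least
`1 / 2048`, an excursion during which it visits at most `6 m` lamps. -/
theorem shannonEntropy_reflectedWalk_le {t s : B} (hst : s * t * s⁻¹ = t⁻¹) {m : ℕ} (hm : 0 < m)
    {ε : ℝ} (hε : ε = 1 / (8 * m)) (h0 : 0 ≤ ε) (h1 : ε ≤ 1) :
    shannonEntropy (convolutionPow ((flipLaw ε h0 h1).bind (stepLaw t s)) (7 * m)) +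
        ENNReal.ofReal (1 / 2048) * (m * ENNReal.ofReal (Real.log 2)) ≤
      ((7 * m : ℕ) : ℝ≥0∞) * shannonEntropy (flipLaw ε h0 h1) +
        ((7 * m : ℕ) : ℝ≥0∞) * ENNReal.ofReal (Real.log 2) := by
  classical
  have hm' : (0 : ℝ) < m := by exact_mod_cast hm
  -- The reflection happens at time `m + a`, and its inverse at time `3 m + b`.
  let word : ℕ × ℕ → List (Option Bool) := fun x =>
    excursionWord (m + x.1) (2 * m - 1 - x.1 + x.2) (4 * m - 1 - x.2)
  set S := (Finset.range m ×ˢ Finset.range m).image word with hS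
  have hinj : Set.InjOn word (Finset.range m ×ˢ Finset.range m : Finset (ℕ × ℕ)) := by
    rintro ⟨a, b⟩ hab ⟨a', b'⟩ hab' h
    simp only [Finset.coe_product, Set.mem_prod, Finset.mem_coe, Finset.mem_range] at hab hab'
    have := excursionWord_inj h
    dsimp only at this
    ext <;> dsimp only <;> omega
  refine le_trans ?_ (shannonEntropy_convolutionPow_bind_add_le (flipLaw ε h0 h1) (stepLaw t s)
    (d := m * ENNReal.ofReal (Real.log 2)) (shannonEntropy_stepLaw_le t s) (7 * m) S ?_)
  · gcongr
    rw [hS, Finset.sum_image hinj]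
    calc ENNReal.ofReal (1 / 2048)
        = ∑ x ∈ Finset.range m ×ˢ Finset.range m, ENNReal.ofReal (1 / (2048 * m ^ 2)) := by
          rw [Finset.sum_const, Finset.card_product, Finset.card_range, nsmul_eq_mul,
            ← ENNReal.ofReal_natCast, ← ENNReal.ofReal_mul (by positivity)]
          congr 1
          push_cast
          field_simp
      _ ≤ _ := by
          refine Finset.sum_le_sum fun x hx => ?_
          simp only [Finset.mem_product, Finset.mem_range] at hx
          exact le_iidWord_excursionWord hm hε h0 h1 (by omega)
  · intro w hw
    obtain ⟨⟨a, b⟩, hab, rfl⟩ := Finset.mem_image.1 hw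
    simp only [Finset.mem_product, Finset.mem_range] at hab
    have hent : shannonEntropy (wordLaw (stepLaw t s) (word (a, b))) ≤
        ((6 * m : ℕ) : ℝ≥0∞) * ENNReal.ofReal (Real.log 2) :=
      shannonEntropy_excursionWord_le hst (by omega)
    calc _ ≤ ((6 * m : ℕ) : ℝ≥0∞) * ENNReal.ofReal (Real.log 2) +
          m * ENNReal.ofReal (Real.log 2) := by gcongr
      _ = _ := by push_cast; ring

end Excursion

/-! ### The discontinuity -/

section Discontinuity

/-- The uniform law on the two free generators. -/
noncomputable def freeStep : PMF (FreeGroup (Fin 2)) :=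
  fairCoin.map fun c => FreeGroup.of (if c then 1 else 0)

theorem shannonEntropy_freeStep : shannonEntropy freeStep = ENNReal.ofReal (Real.log 2) := by
  rw [freeStep, shannonEntropy_map_of_injOn, shannonEntropy_fairCoin]
  refine Function.Injective.injOn fun c d h => ?_
  have := FreeGroup.of_injective h
  revert this
  cases c <;> cases d <;> simp

variable {B : Type*} [Group B]

/-- The free generators generate a free semigroup, since their images in a lamplighter group do. -/
theorem shannonEntropy_convolutionPow_freeStep {t : B} (ht : ∀ n : ℕ, n ≠ 0 → t ^ n ≠ 1) (n : ℕ) :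
    shannonEntropy (convolutionPow freeStep n) = n * ENNReal.ofReal (Real.log 2) := by
  classical
  let φ : FreeGroup (Fin 2) →* Lamplighter B := FreeGroup.lift fun i => switchMove (i = 1) t
  have hφ : ∀ c : Bool, φ (FreeGroup.of (if c then 1 else 0)) = switchMove c t := by
    intro c
    cases c <;> simp [φ]
  have hmap : freeStep.map φ = switchStep t := by
    rw [freeStep, PMF.map_comp, switchStep]
    congr 1
    exact funext hφ
  have hmem : ∀ n, ∀ x ∈ (convolutionPow freeStep n).support,
      φ x ∈ (convolutionPow (switchStep t) n).support := by
    intro n x hx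
    rw [← hmap, convolutionPow_map]
    exact (PMF.mem_support_map_iff _ _ _).2 ⟨x, hx, rfl⟩
  rw [shannonEntropy_convolutionPow_of_decodable, shannonEntropy_freeStep]
  intro n x hx y hy a ha b hb h
  simp only [freeStep, PMF.mem_support_map_iff] at ha hb
  obtain ⟨c, -, rfl⟩ := ha
  obtain ⟨d, -, rfl⟩ := hb
  have h' := congrArg φ h
  rw [map_mul, map_mul, hφ, hφ] at h'
  have := switchStep_decodable ht n _ (hmem n x hx) _ (hmem n y hy) _
    (mem_support_switchStep.2 ⟨c, rfl⟩) _ (mem_support_switchStep.2 ⟨d, rfl⟩) h'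
  rw [switchMove_injective t this]

theorem finite_support_stepLaw (t s : B) (i : Option Bool) : (stepLaw t s i).support.Finite := by
  cases i with
  | none =>
    rw [stepLaw, switchStep, PMF.support_map]
    exact (Set.toFinite _).image _
  | some c => simp [stepLaw]

theorem ofReal_log_two_pos : 0 < ENNReal.ofReal (Real.log 2) :=
  ENNReal.ofReal_pos.2 (Real.log_pos one_lt_two)

/-- A base group with an element `t` of infinite order and an element `s` that inverts `t` gives an
entropy discontinuity: the walk by `t` alone never returns to a lamp, while arbitrarily rare
reflections by `s` and `s⁻¹` make it revisit a fixed proportion of the lamps. -/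
theorem hasPositiveEntropyDiscontinuity_of_reflection {t s : B}
    (ht : ∀ n : ℕ, n ≠ 0 → t ^ n ≠ 1) (hst : s * t * s⁻¹ = t⁻¹) :
    HasPositiveEntropyDiscontinuity (FreeGroup (Fin 2) × Lamplighter B) := by
  set Λ := ENNReal.ofReal (Real.log 2) with hΛ
  have hΛtop : Λ ≠ ∞ := ENNReal.ofReal_ne_top
  let ε : ℕ → ℝ := fun k => 1 / (8 * ((k + 1 : ℕ) : ℝ))
  have h0 : ∀ k, 0 ≤ ε k := fun k => by positivity
  have h1 : ∀ k, ε k ≤ 1 := fun k => by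
    have : (1 : ℝ) ≤ ((k + 1 : ℕ) : ℝ) := by exact_mod_cast Nat.succ_pos k
    exact div_le_one_of_le₀ (by linarith) (by positivity)
  have hε : Tendsto ε atTop (𝓝 0) := by
    have := (tendsto_one_div_add_atTop_nhds_zero_nat (𝕜 := ℝ)).const_mul (1 / 8)
    rw [mul_zero] at this
    refine this.congr fun k => ?_
    simp only [ε]
    push_cast
    field_simp
  set π : ℕ → PMF (Option Bool) := fun k => flipLaw (ε k) (h0 k) (h1 k) with hπ
  have hπlim := tendsto_flipLaw ε h0 h1 hε
  have hπent : Tendsto (fun k => shannonEntropy (π k)) atTop (𝓝 0) := by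
    have := tendsto_shannonEntropy hπlim
    rwa [shannonEntropy_pure] at this
  set ν := prodPMF freeStep (switchStep t) with hν
  set νs : ℕ → PMF (FreeGroup (Fin 2) × Lamplighter B) := fun k =>
    prodPMF freeStep ((π k).bind (stepLaw t s)) with hνs
  have hνpow : ∀ n : ℕ, shannonEntropy (convolutionPow ν n) = n * (Λ + Λ) := by
    intro n
    rw [hν, convolutionPow_prodPMF, shannonEntropy_prodPMF,
      shannonEntropy_convolutionPow_freeStep ht, shannonEntropy_convolutionPow_switchStep ht,
      mul_add]
  have hνspow : ∀ k n, shannonEntropy (convolutionPow (νs k) n) =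
      n * Λ + shannonEntropy (convolutionPow ((π k).bind (stepLaw t s)) n) := by
    intro k n
    rw [hνs, convolutionPow_prodPMF, shannonEntropy_prodPMF,
      shannonEntropy_convolutionPow_freeStep ht]
  have hνlim := asymptoticEntropyExists_of_tendsto (μ := ν) (c := Λ + Λ) <| by
    refine tendsto_const_nhds.congr' ?_
    filter_upwards [eventually_ne_atTop 0] with n hn
    rw [hνpow, mul_comm, ENNReal.mul_div_cancel_right (by exact_mod_cast hn)
      (ENNReal.natCast_ne_top n)]
  have hνsfin : ∀ k, shannonEntropy (νs k) ≠ ∞ := by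
    intro k
    rw [hνs, shannonEntropy_prodPMF, shannonEntropy_freeStep]
    refine ENNReal.add_ne_top.2 ⟨hΛtop, ne_top_of_le_ne_top ?_ (shannonEntropy_bind_le _ _)⟩
    refine ENNReal.add_ne_top.2 ⟨ne_top_of_le_ne_top ENNReal.ofReal_ne_top
      (shannonEntropy_le_log_card_fintype _), ne_top_of_le_ne_top hΛtop (b := Λ) ?_⟩
    calc ∑' i, π k i * shannonEntropy (stepLaw t s i) ≤ ∑' i, π k i * Λ := by
          gcongr
          exact shannonEntropy_stepLaw_le t s _
      _ = Λ := by rw [ENNReal.tsum_mul_right, PMF.tsum_coe, one_mul]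
  have hex := fun k => asymptoticEntropy_exists_and_le (hνsfin k)
  -- The drop in entropy, from the excursions among the first `7 (k + 1)` steps.
  set c := ENNReal.ofReal (1 / (7 * 2048)) * Λ with hc
  have hc0 : c ≠ 0 := mul_ne_zero (by norm_num) ofReal_log_two_pos.ne'
  have hupper : ∀ k, asymptoticEntropy (νs k) + c ≤ shannonEntropy (π k) + (Λ + Λ) := by
    intro k
    have hn0 : ((7 * (k + 1) : ℕ) : ℝ≥0∞) ≠ 0 := by
      exact_mod_cast (by omega : 7 * (k + 1) ≠ 0)
    have hntop : ((7 * (k + 1) : ℕ) : ℝ≥0∞) ≠ ∞ := ENNReal.natCast_ne_top _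
    have hle := (hex k).2 (7 * (k + 1)) (by omega)
    rw [ENNReal.le_div_iff_mul_le (Or.inl hn0) (Or.inl hntop), hνspow] at hle
    have hdrop := shannonEntropy_reflectedWalk_le hst (Nat.succ_pos k) (ε := ε k) rfl (h0 k) (h1 k)
    have hcmul : c * ((7 * (k + 1) : ℕ) : ℝ≥0∞) =
        ENNReal.ofReal (1 / 2048) * ((k + 1 : ℕ) * Λ) := by
      have : ENNReal.ofReal (1 / (7 * 2048)) * 7 = ENNReal.ofReal (1 / 2048) := by
        rw [← ENNReal.ofReal_ofNat 7, ← ENNReal.ofReal_mul (by norm_num)]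
        norm_num
      rw [hc, ← this]
      push_cast
      ring
    rw [← ENNReal.mul_le_mul_iff_left hn0 hntop, add_mul, hcmul]
    calc _ ≤ ((7 * (k + 1) : ℕ) : ℝ≥0∞) * Λ +
          (shannonEntropy (convolutionPow ((π k).bind (stepLaw t s)) (7 * (k + 1))) +
            ENNReal.ofReal (1 / 2048) * ((k + 1 : ℕ) * Λ)) := by
          rw [← add_assoc]
          gcongr
      _ ≤ ((7 * (k + 1) : ℕ) : ℝ≥0∞) * Λ + (((7 * (k + 1) : ℕ) : ℝ≥0∞) * shannonEntropy (π k) +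
            ((7 * (k + 1) : ℕ) : ℝ≥0∞) * Λ) := by
          gcongr
      _ = _ := by ring
  refine ⟨ν, νs, ?_, ?_, hνlim.1, fun k => (hex k).1, fun k => ?_, ?_⟩
  · have hfin : (freeStep.support ×ˢ ⋃ i, (stepLaw t s i).support).Finite := by
      refine Set.Finite.prod ?_ (Set.finite_iUnion (finite_support_stepLaw t s))
      rw [freeStep, PMF.support_map]
      exact (Set.toFinite _).image _
    refine ⟨hfin.toFinset, ?_, fun k => ?_⟩
    · intro x hx
      rw [mem_support_prodPMF] at hx
      rw [Set.Finite.coe_toFinset]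
      exact ⟨hx.1, Set.mem_iUnion.2 ⟨none, hx.2⟩⟩
    · intro x hx
      rw [mem_support_prodPMF, PMF.mem_support_bind_iff] at hx
      obtain ⟨hx1, i, -, hi⟩ := hx
      rw [Set.Finite.coe_toFinset]
      exact ⟨hx1, Set.mem_iUnion.2 ⟨i, hi⟩⟩
  · rintro ⟨x, y⟩
    simp only [hν, hνs, prodPMF_apply]
    refine ENNReal.Tendsto.const_mul ?_ (Or.inr (freeStep.apply_ne_top x))
    have := tendsto_bind (stepLaw t s) hπlim y
    rwa [PMF.pure_bind] at this
  · refine ofReal_log_two_pos.trans_le (ge_of_tendsto (hex k).1 ?_)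
    filter_upwards [eventually_ne_atTop 0] with n hn
    rw [ENNReal.le_div_iff_mul_le (Or.inl (by exact_mod_cast hn))
      (Or.inl (ENNReal.natCast_ne_top n)), hνspow, mul_comm]
    exact le_self_add
  · have hlim : Tendsto (fun k => shannonEntropy (π k) + (Λ + Λ) - c) atTop
        (𝓝 (0 + (Λ + Λ) - c)) :=
      ENNReal.Tendsto.sub (hπent.add tendsto_const_nhds) tendsto_const_nhds
        (Or.inl (by simpa using hΛtop))
    calc limsup (fun k => asymptoticEntropy (νs k)) atTop
        ≤ limsup (fun k => shannonEntropy (π k) + (Λ + Λ) - c) atTop :=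
          limsup_le_limsup (Eventually.of_forall fun k =>
            ENNReal.le_sub_of_add_le_right (ENNReal.mul_ne_top ENNReal.ofReal_ne_top hΛtop)
              (hupper k))
      _ = Λ + Λ - c := by rw [hlim.limsup_eq, zero_add]
      _ < Λ + Λ := ENNReal.sub_lt_self (ENNReal.add_ne_top.2 ⟨hΛtop, hΛtop⟩)
          (ofReal_log_two_pos.trans_le le_self_add).ne' hc0
      _ = asymptoticEntropy ν := hνlim.2.symm

theorem dihedralGroup_zero_r_pow_ne_one (n : ℕ) (hn : n ≠ 0) :
    (DihedralGroup.r 1 : DihedralGroup 0) ^ n ≠ 1 := by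
  rw [DihedralGroup.r_one_pow, DihedralGroup.one_def, ne_eq, DihedralGroup.r.injEq]
  exact_mod_cast hn

theorem dihedralGroup_zero_conj :
    (DihedralGroup.sr 0 * DihedralGroup.r 1 * (DihedralGroup.sr 0)⁻¹ : DihedralGroup 0) =
      (DihedralGroup.r 1)⁻¹ := by
  simp

theorem dihedralGroup_zero_fg : Group.FG (DihedralGroup 0) := by
  refine Group.fg_iff.2 ⟨{DihedralGroup.r 1, DihedralGroup.sr 0}, ?_, Set.toFinite _⟩
  set K := Subgroup.closure ({DihedralGroup.r 1, DihedralGroup.sr 0} : Set (DihedralGroup 0))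
  have hr : ∀ i : ZMod 0, DihedralGroup.r i ∈ K := fun i => by
    obtain ⟨k, rfl⟩ := ZMod.intCast_surjective i
    rw [← DihedralGroup.r_one_zpow]
    exact K.zpow_mem (Subgroup.subset_closure (Or.inl rfl)) k
  rw [eq_top_iff]
  rintro (i | i) -
  · exact hr i
  · have := K.mul_mem (Subgroup.subset_closure (Or.inr rfl) : DihedralGroup.sr 0 ∈ K) (hr i)
    rwa [DihedralGroup.sr_mul_r, zero_add] at this

/-- The infinite dihedral group is the quotient of `BS(1, -1)` in which `b` is a reflection; so `a`
has infinite order in `BS(1, -1)`. -/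
theorem baumslagSolitar_of_zero_pow_ne_one (n : ℕ) (hn : n ≠ 0) :
    (PresentedGroup.of 0 : BaumslagSolitar 1 (-1)) ^ n ≠ 1 := by
  intro h
  let f : Fin 2 → DihedralGroup 0 := ![DihedralGroup.r 1, DihedralGroup.sr 0]
  have hrel : ∀ r ∈ ({FreeGroup.of 1 * FreeGroup.of 0 ^ (1 : ℤ) * (FreeGroup.of 1)⁻¹ *
      (FreeGroup.of 0 ^ (-1 : ℤ))⁻¹} : Set (FreeGroup (Fin 2))), FreeGroup.lift f r = 1 := by
    rintro r rfl
    simp [f]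
  have := congrArg (PresentedGroup.toGroup hrel) h
  rw [map_pow, map_one, PresentedGroup.toGroup.of] at this
  exact dihedralGroup_zero_r_pow_ne_one n hn this

theorem baumslagSolitar_conj :
    (PresentedGroup.of 1 * PresentedGroup.of 0 * (PresentedGroup.of 1)⁻¹ :
      BaumslagSolitar 1 (-1)) = (PresentedGroup.of 0)⁻¹ := by
  have h := PresentedGroup.one_of_mem (rels := ({FreeGroup.of 1 * FreeGroup.of 0 ^ (1 : ℤ) *
    (FreeGroup.of 1)⁻¹ * (FreeGroup.of 0 ^ (-1 : ℤ))⁻¹} : Set (FreeGroup (Fin 2)))) rfl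
  simp only [map_mul, map_inv, zpow_one, zpow_neg, inv_inv] at h
  exact eq_inv_of_mul_eq_one_left h

theorem baumslagSolitar_fg (m n : ℤ) : Group.FG (BaumslagSolitar m n) :=
  inferInstanceAs (Group.FG (FreeGroup (Fin 2) ⧸ _))

end Discontinuity

/-- The products of the free group of rank two with the lamplighter groups over the infinite
dihedral group and over `BS(1, -1)` are finitely generated, and on each of them asymptotic entropy
drops along a pointwise convergent sequence of probability measures of positive asymptotic entropy
supported in a fixed finite set. -/
theorem mainTheorem6 :
    (Group.FG (FreeGroup (Fin 2) × Lamplighter (DihedralGroup 0)) ∧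
      HasPositiveEntropyDiscontinuity (FreeGroup (Fin 2) × Lamplighter (DihedralGroup 0))) ∧
    (Group.FG (FreeGroup (Fin 2) × Lamplighter (BaumslagSolitar 1 (-1))) ∧
      HasPositiveEntropyDiscontinuity
        (FreeGroup (Fin 2) × Lamplighter (BaumslagSolitar 1 (-1)))) := by
  have := dihedralGroup_zero_fg
  have := baumslagSolitar_fg 1 (-1)
  have := lamplighter_fg (B := DihedralGroup 0)
  have := lamplighter_fg (B := BaumslagSolitar 1 (-1))
  exact ⟨⟨inferInstance, hasPositiveEntropyDiscontinuity_of_reflection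
      dihedralGroup_zero_r_pow_ne_one dihedralGroup_zero_conj⟩,
    ⟨inferInstance, hasPositiveEntropyDiscontinuity_of_reflection
      baumslagSolitar_of_zero_pow_ne_one baumslagSolitar_conj⟩⟩
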